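/- Let $n\ge 0$ and let $\|\cdot\|_0$, $\|\cdot\|_1$ and $\|\cdot\|_*$ be three Hermitian norms on $\mathbf{C}^n$, that is, norms induced by (arbitrary) positive definite Hermitian inner products $\langle\cdot,\cdot\rangle_0$, $\langle\cdot,\cdot\rangle_1$ and $\langle\cdot,\cdot\rangle_*$. Let $A$ and $B$ be the linear operators on $\mathbf{C}^n$ determined by $$\|x\|_1^2=\langle Ax,x\rangle_0,\qquad \|x\|_*^2=\langle Bx,x\rangle_0,\qquad x\in\mathbf{C}^n,$$ and assume that every eigenvalue of $A$ has multiplicity one. Write $\mathcal{H}_0,\mathcal{H}_1,\mathcal{H}_*$ for $\mathbf{C}^n$ with the respective norms. Say that $\mathcal{H}_*$ is *exact interpolation* with respect to the couple $(\mathcal{H}_0,\mathcal{H}_1)$ if $$\|T\|_{\mathcal{L}(\mathcal{H}_*)}\le\max\bigl\{\|T\|_{\mathcal{L}(\mathcal{H}_0)},\|T\|_{\mathcal{L}(\mathcal{H}_1)}\bigr\}$$ for every linear map $T:\mathbf{C}^n\to\mathbf{C}^n$, where the norms are operator norms. Let $P'$ be the class of functions $h$ on $(0,\infty)$ of the form $$h(\lambda)=\int_{[0,\infty]}\frac{(1+t)\lambda}{1+t\lambda}\,d\varrho(t),\qquad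 \lambda>0,$$ where $\varrho$ is a positive Radon measure on the compactified half-line $[0,\infty]$ (the integrand being $1$ at $t=\infty$). Then $\mathcal{H}_*$ is exact interpolation with respect to $(\mathcal{H}_0,\mathcal{H}_1)$ if and only if there is a function $h\in P'$ such that $B=h(A)$, where $h(A)$ is given by the functional calculus of the self-adjoint operator $A$ on $\mathcal{H}_0$, whose spectrum is contained in $(0,\infty)$. -/

import Mathlib

open scoped ENNReal

noncomputable section

/-- A finite-dimensional complex vector space `V`, regarded as a Hilbert space for the
Hermitian (positive definite sesquilinear) inner product `c`. -/
def HermSpace {V : Type*} [AddCommGroup V] [Module ℂ V]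
    (_c : InnerProductSpace.Core ℂ V) : Type _ := V

instance HermSpace.instNormedAddCommGroup {V : Type*} [AddCommGroup V] [Module ℂ V] (c : InnerProductSpace.Core ℂ V) :
    NormedAddCommGroup (HermSpace c) :=
  @InnerProductSpace.Core.toNormedAddCommGroup ℂ V _ _ _ c

instance HermSpace.instInnerProductSpace {V : Type*} [AddCommGroup V] [Module ℂ V] (c : InnerProductSpace.Core ℂ V) :
    InnerProductSpace ℂ (HermSpace c) :=
  InnerProductSpace.ofCore c.toCore

instance HermSpace.instFiniteDimensional {V : Type*} [AddCommGroup V] [Module ℂ V] [FiniteDimensional ℂ V]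
    (c : InnerProductSpace.Core ℂ V) : FiniteDimensional ℂ (HermSpace c) :=
  inferInstanceAs (FiniteDimensional ℂ V)

instance HermSpace.instCompleteSpace {V : Type*} [AddCommGroup V] [Module ℂ V] [FiniteDimensional ℂ V]
    (c : InnerProductSpace.Core ℂ V) : CompleteSpace (HermSpace c) :=
  FiniteDimensional.complete ℂ (HermSpace c)

/-- The identity map from `V` to the Hilbert space `(V, c)`. -/
def HermSpace.equiv {V : Type*} [AddCommGroup V] [Module ℂ V]
    (c : InnerProductSpace.Core ℂ V) : V ≃ₗ[ℂ] HermSpace c :=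
  LinearEquiv.refl ℂ V

/-- A linear map of `V`, regarded as a bounded operator on the Hilbert space `(V, c)`.
(All linear maps are bounded, because `V` is finite-dimensional.) -/
def HermSpace.op {V : Type*} [AddCommGroup V] [Module ℂ V] [FiniteDimensional ℂ V]
    (c : InnerProductSpace.Core ℂ V) (T : Module.End ℂ V) :
    HermSpace c →L[ℂ] HermSpace c :=
  LinearMap.toContinuousLinearMap ((HermSpace.equiv c).conj T)

/-- `A` is the operator representing the squared norm of `c₁` in the Hilbert space `(V, c₀)`:
`‖x‖₁² = ⟨A x, x⟩₀` for all `x`. -/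
def IsRepresentingOperator {V : Type*} [AddCommGroup V] [Module ℂ V]
    (c₀ c₁ : InnerProductSpace.Core ℂ V) (A : Module.End ℂ V) : Prop :=
  ∀ x : V, c₁.inner x x = c₀.inner (A x) x

/-- `(V, c)` is an exact interpolation space with respect to the couple `((V, c₀), (V, c₁))`:
for every couple map `T`, the operator norm of `T` on `(V, c)` is at most the maximum of its
operator norms on `(V, c₀)` and on `(V, c₁)`. As all three spaces equal the same
finite-dimensional `V` as sets, every linear map is a couple map, and `(V, c)` is
automatically intermediate. -/
def IsExactInterpolation {V : Type*} [AddCommGroup V] [Module ℂ V] [FiniteDimensional ℂ V]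
    (c₀ c₁ c : InnerProductSpace.Core ℂ V) : Prop :=
  ∀ T : Module.End ℂ V,
    ‖HermSpace.op c T‖ ≤ max ‖HermSpace.op c₀ T‖ ‖HermSpace.op c₁ T‖

/-- The kernel `(1 + t) l / (1 + t l)` for `l > 0` and `t ∈ [0, ∞]`, with its limit `1` at
`t = ∞`. -/
def pickKernel (l : ℝ) (t : ℝ≥0∞) : ℝ :=
  if t = ∞ then 1 else (1 + t.toReal) * l / (1 + t.toReal * l)

/-- The class `P'` of functions on `(0, ∞)` of the form
`h(l) = ∫_{[0, ∞]} (1 + t) l / (1 + t l) dϱ(t)` with `ϱ` a positive Radon measure on the compact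
space `[0, ∞]`, that is, a finite Borel measure there. Values of `h` off `(0, ∞)` are
irrelevant. -/
def IsPickPrime (h : ℝ → ℝ) : Prop :=
  ∃ ϱ : MeasureTheory.Measure ℝ≥0∞, MeasureTheory.IsFiniteMeasure ϱ ∧
    ∀ l : ℝ, 0 < l → h l = ∫ t, pickKernel l t ∂ϱ

end

/-! An orthonormal eigenbasis of `A` in $\mathcal{H}_0$ turns the first two squared norms into
$\sum|z_i|^2$ and $\sum l_i|z_i|^2$, with the $l_i$ distinct and positive.

Sufficiency: up to a factor, the kernel at $t$ is the infimum of $|p|^2/t+l|q|^2$ over splittings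
$z=p+q$, so a map bounded for both norms is bounded, with the same constant, for the norm of each
kernel. Integration over $\varrho$ finishes (`IsPickVector.contracts`).

Necessity: coordinate reflections preserve both norms, so exactness makes the third norm diagonal
too, $\sum h_i|z_i|^2$ (`IsExactInterpolation.exists_isDiagonalNorm`). By Hahn–Banach it remains to
show $\sum h_is_i\ge0$ whenever $\sum s_il_i/(u+l_i)\ge0$ for all $u\ge0$ (`isPickVector_of_dual`).
Clearing denominators gives a polynomial of degree $<n$, nonnegative on the half-line, hence equal
to $a^2+Xb^2$ (`isHalfLineSquare_of_nonneg`). This writes $\sum h_is_i$ as two sums $\sum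
h_ig_iq(-l_i)^2$ with $g$ explicit and alternating in sign. Each is nonnegative by testing
interpolation on one real map: Lagrange extrapolation from the nodes with $g_i>0$ to the others
(`IsDiagonalInterpolation.sum_nonneg`). That this map contracts both given norms follows from
Lagrange identities for the nodes $-l_i$. -/

/-! ### Polynomials that are nonnegative on the half-line -/

section HalfLine

open Polynomial

/-- The polynomials of the form `a ^ 2 + X * b ^ 2`. -/
def IsHalfLineSquare (p : ℝ[X]) : Prop := ∃ a b : ℝ[X], p = a ^ 2 + X * b ^ 2

/-- $a^2+Xb^2$ is the norm of $a+\sqrt{-X}\,b$, and norms multiply. -/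
theorem IsHalfLineSquare.mul {p q : ℝ[X]} (hp : IsHalfLineSquare p) (hq : IsHalfLineSquare q) :
    IsHalfLineSquare (p * q) := by
  obtain ⟨a, b, rfl⟩ := hp
  obtain ⟨c, d, rfl⟩ := hq
  exact ⟨a * c - X * b * d, a * d + b * c, by ring⟩

theorem IsHalfLineSquare.sq (p : ℝ[X]) : IsHalfLineSquare (p ^ 2) := ⟨p, 0, by ring⟩

theorem isHalfLineSquare_C {c : ℝ} (hc : 0 ≤ c) : IsHalfLineSquare (C c) :=
  ⟨C √c, 0, by rw [← C_pow, Real.sq_sqrt hc]; ring⟩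

theorem isHalfLineSquare_X_sub_C {r : ℝ} (hr : r ≤ 0) : IsHalfLineSquare (X - C r) :=
  ⟨C √(-r), 1, by rw [← C_pow, Real.sq_sqrt (by linarith), C_neg]; ring⟩

theorem isHalfLineSquare_quadratic (z : ℂ) :
    IsHalfLineSquare (X ^ 2 - C (2 * z.re) * X + C (‖z‖ ^ 2)) := by
  refine ⟨X - C ‖z‖, C √(2 * ‖z‖ - 2 * z.re), ?_⟩
  have h := Complex.re_le_norm z
  rw [← C_pow (a := √_), Real.sq_sqrt (by linarith)]
  simp only [C_mul, C_sub, C_pow, C_ofNat]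
  ring

theorem eval_nonneg_of_nonneg_gt {p : ℝ[X]} {r : ℝ} (h : ∀ u, r < u → 0 ≤ p.eval u) :
    0 ≤ p.eval r :=
  ge_of_tendsto (x := nhdsWithin r (Set.Ioi r)) (p.continuous.tendsto r |>.mono_left inf_le_left)
    (Filter.eventually_of_mem self_mem_nhdsWithin fun u hu => h u hu)

/-- Induction on the degree, splitting off the factor of a complex root: a real root $r\le0$, a
positive root (necessarily double), or a conjugate pair. -/
theorem isHalfLineSquare_of_nonneg (p : ℝ[X]) (h : ∀ u, 0 ≤ u → 0 ≤ p.eval u) :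
    IsHalfLineSquare p := by
  induction hd : p.natDegree using Nat.strong_induction_on generalizing p with
  | _ d ih =>
    subst hd
    by_cases hdeg : p.natDegree = 0
    · obtain ⟨c, rfl⟩ := natDegree_eq_zero.1 hdeg
      exact isHalfLineSquare_C (by simpa using h 0 le_rfl)
    have hp0 : p ≠ 0 := by rintro rfl; simp at hdeg
    obtain ⟨z, hz⟩ := IsAlgClosed.exists_aeval_eq_zero ℂ p
      (fun h0 => hdeg (natDegree_eq_of_degree_eq_some h0))
    by_cases him : z.im = 0
    · obtain ⟨r, rfl⟩ : ∃ r : ℝ, (r : ℂ) = z := ⟨z.re, by apply Complex.ext <;> simp [him]⟩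
      have hroot : p.IsRoot r := by
        have : aeval (algebraMap ℝ ℂ r) p = 0 := hz
        rw [aeval_algebraMap_apply] at this
        simpa using this
      obtain ⟨q, rfl⟩ := dvd_iff_isRoot.2 hroot
      have hq0 : q ≠ 0 := right_ne_zero_of_mul hp0
      have hdegq : ((X - C r) * q).natDegree = q.natDegree + 1 := by
        rw [natDegree_mul (X_sub_C_ne_zero r) hq0, natDegree_X_sub_C, add_comm]
      have hgt : ∀ u, 0 ≤ u → r < u → 0 ≤ q.eval u := fun u hu hru => by
        have := h u hu
        rw [eval_mul, eval_sub, eval_X, eval_C] at this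
        exact nonneg_of_mul_nonneg_right this (sub_pos.2 hru)
      rcases le_or_gt r 0 with hr | hr
      · refine (isHalfLineSquare_X_sub_C hr).mul (ih _ (by omega) q (fun u hu => ?_) rfl)
        rcases hu.eq_or_lt with rfl | hu'
        · exact eval_nonneg_of_nonneg_gt fun u hu => hgt u hu.le (hr.trans_lt hu)
        · exact hgt u hu (hr.trans_lt hu')
      · have hlt : ∀ u, 0 ≤ u → u < r → q.eval u ≤ 0 := fun u hu hru => by
          have := h u hu
          rw [eval_mul, eval_sub, eval_X, eval_C] at this
          by_contra hcon
          push Not at hcon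
          nlinarith [mul_pos (sub_pos.2 hru) hcon]
        -- The cofactor changes sign at the positive root $r$, so it vanishes there.
        have hq : q.IsRoot r := by
          refine le_antisymm ?_ (eval_nonneg_of_nonneg_gt fun u hu => hgt u (hr.trans hu).le hu)
          refine le_of_tendsto (x := nhdsWithin r (Set.Iio r))
            (q.continuous.tendsto r |>.mono_left inf_le_left) ?_
          filter_upwards [self_mem_nhdsWithin, nhdsWithin_le_nhds (Ioi_mem_nhds hr)] with u h1 h2
          exact hlt u (le_of_lt h2) h1
        obtain ⟨s, rfl⟩ := dvd_iff_isRoot.2 hq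
        have hs0 : s ≠ 0 := right_ne_zero_of_mul hq0
        have hdegs : ((X - C r) * s).natDegree = s.natDegree + 1 := by
          rw [natDegree_mul (X_sub_C_ne_zero r) hs0, natDegree_X_sub_C, add_comm]
        have hne : ∀ u, 0 ≤ u → u ≠ r → 0 ≤ s.eval u := fun u hu hru => by
          have := h u hu
          rw [eval_mul, eval_mul, eval_sub, eval_X, eval_C, ← mul_assoc] at this
          exact nonneg_of_mul_nonneg_right this (mul_self_pos.2 (sub_ne_zero.2 hru))
        rw [← mul_assoc, ← pow_two]
        refine (IsHalfLineSquare.sq _).mul (ih _ (by omega) s (fun u hu => ?_) rfl)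
        by_cases hur : u = r
        · subst hur
          exact eval_nonneg_of_nonneg_gt fun v hv => hne v (hr.trans hv).le hv.ne'
        · exact hne u hu hur
    · obtain ⟨q, hq⟩ := p.quadratic_dvd_of_aeval_eq_zero_im_ne_zero hz him
      have hmonic : (X ^ 2 - C (2 * z.re) * X + C (‖z‖ ^ 2)).natDegree = 2 := by compute_degree!
      rw [hq] at hp0 ⊢
      have hdegp := congrArg natDegree hq
      rw [natDegree_mul (left_ne_zero_of_mul hp0) (right_ne_zero_of_mul hp0), hmonic] at hdegp
      refine (isHalfLineSquare_quadratic z).mul (ih _ (by omega) q (fun u hu => ?_) rfl)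
      have hpos : 0 < (X ^ 2 - C (2 * z.re) * X + C (‖z‖ ^ 2)).eval u := by
        have h1 : ‖z‖ ^ 2 = z.re ^ 2 + z.im ^ 2 := by
          rw [← Complex.normSq_eq_norm_sq, Complex.normSq_apply]; ring
        have h2 : 0 < z.im ^ 2 := by positivity
        simp only [eval_add, eval_sub, eval_mul, eval_pow, eval_X, eval_C]
        nlinarith [sq_nonneg (u - z.re)]
      have := h u hu
      rw [hq, eval_mul] at this
      exact nonneg_of_mul_nonneg_right this hpos

/-- The two summands have degrees of opposite parity, so their leading terms cannot cancel. -/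
theorem natDegree_halfLineSquare_bounds {p a b : ℝ[X]} (h : p = a ^ 2 + X * b ^ 2) :
    2 * a.natDegree ≤ p.natDegree ∧ (b ≠ 0 → 2 * b.natDegree + 1 ≤ p.natDegree) := by
  have ha : (a ^ 2).natDegree = 2 * a.natDegree := natDegree_pow a 2
  rcases eq_or_ne b 0 with rfl | hb
  · simp [h, ha]
  have hb' : (X * b ^ 2).natDegree = 2 * b.natDegree + 1 := by
    rw [natDegree_mul X_ne_zero (pow_ne_zero 2 hb), natDegree_pow, natDegree_X, add_comm]
  rcases lt_or_gt_of_ne (show (a ^ 2).natDegree ≠ (X * b ^ 2).natDegree by omega) with hlt | hlt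
  · rw [h, natDegree_add_eq_right_of_natDegree_lt hlt]
    exact ⟨by omega, fun _ => hb'.ge⟩
  · rw [h, natDegree_add_eq_left_of_natDegree_lt hlt]
    exact ⟨by omega, fun _ => by omega⟩

/-- The bounds are exactly the numbers of even and of odd indices below $n$, which later count the
nodes of positive weight. -/
theorem degree_lt_of_halfLineSquare {p a b : ℝ[X]} (h : p = a ^ 2 + X * b ^ 2) {n : ℕ}
    (hn : 0 < n) (hp : p.degree < n) :
    a.degree < ((n + 1) / 2 : ℕ) ∧ b.degree < (n / 2 : ℕ) := by
  obtain ⟨h1, h2⟩ := natDegree_halfLineSquare_bounds h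
  have hp' : p.natDegree < n := by
    rcases eq_or_ne p 0 with rfl | hp0
    · simpa using hn
    · exact (natDegree_lt_iff_degree_lt hp0).2 hp
  constructor
  · exact degree_le_natDegree.trans_lt (by exact_mod_cast (by omega : a.natDegree < (n + 1) / 2))
  · rcases eq_or_ne b 0 with rfl | hb
    · simp
    · have := h2 hb
      exact degree_le_natDegree.trans_lt (by exact_mod_cast (by omega : b.natDegree < n / 2))

theorem coeff_nonneg_of_natDegree_le {p : ℝ[X]} {m : ℕ} (hp : p.natDegree ≤ m)
    (h : 0 ≤ p.leadingCoeff) : 0 ≤ p.coeff m := by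
  rcases hp.eq_or_lt with rfl | hlt
  · exact h
  · rw [coeff_eq_zero_of_natDegree_lt hlt]

end HalfLine

/-! ### Diagonal quadratic forms and Lagrange interpolation -/

section Diagonal

open Polynomial Finset

variable {n : ℕ}

/-- The diagonal form `∑ h i * x i ^ 2` interpolates between `∑ x i ^ 2` and `∑ l i * x i ^ 2`
with respect to real linear maps. -/
def IsDiagonalInterpolation (l h : Fin n → ℝ) : Prop :=
  ∀ T : (Fin n → ℝ) →ₗ[ℝ] (Fin n → ℝ),
    (∀ x, ∑ i, T x i ^ 2 ≤ ∑ i, x i ^ 2) →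
    (∀ x, ∑ i, l i * T x i ^ 2 ≤ ∑ i, l i * x i ^ 2) →
    ∀ x, ∑ i, h i * T x i ^ 2 ≤ ∑ i, h i * x i ^ 2

/-- The map that extends the (rescaled) values on `{i | 0 < g i}` by Lagrange interpolation to
(rescaled) values on the complement. -/
noncomputable def interpolationMap (g v : Fin n → ℝ) : (Fin n → ℝ) →ₗ[ℝ] (Fin n → ℝ) :=
  LinearMap.pi fun j => if 0 < g j then 0 else
    √(-g j) • ((leval (v j)).comp ((Lagrange.interpolate {i | 0 < g i} v).comp
      (LinearMap.pi fun i => (√(g i))⁻¹ • LinearMap.proj i)))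

/-- At a node with $g_i>0$ the interpolant equals $x_i/\sqrt{g_i}$ and the right side cancels to
$0$; elsewhere only $-g_i$ times its square remains. -/
theorem interpolationMap_apply_sq {g v : Fin n → ℝ} (hv : Function.Injective v)
    (x : Fin n → ℝ) (i : Fin n) :
    interpolationMap g v x i ^ 2 = (if 0 < g i then x i ^ 2 else 0) -
      g i * (Lagrange.interpolate {i | 0 < g i} v (fun i => (√(g i))⁻¹ * x i)).eval (v i) ^ 2 := by
  unfold interpolationMap
  by_cases hi : 0 < g i
  · rw [Lagrange.eval_interpolate_at_node _ hv.injOn (by simpa using hi)]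
    simp only [LinearMap.pi_apply, hi, if_true, LinearMap.zero_apply, mul_pow, inv_pow,
      Real.sq_sqrt hi.le]
    field_simp
    ring
  · simp only [LinearMap.pi_apply, hi, if_false, LinearMap.smul_apply, LinearMap.comp_apply,
      smul_eq_mul, mul_pow, Real.sq_sqrt (neg_nonneg.2 (not_lt.1 hi)), leval_apply, zero_sub,
      neg_mul]
    rfl

theorem sum_mul_interpolationMap_sq {g v : Fin n → ℝ} (hv : Function.Injective v)
    (m x : Fin n → ℝ) :
    ∑ i, m i * interpolationMap g v x i ^ 2 = ∑ i, m i * (if 0 < g i then x i ^ 2 else 0) -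
      ∑ i, m i * g i * (Lagrange.interpolate {i | 0 < g i} v
        (fun i => (√(g i))⁻¹ * x i)).eval (v i) ^ 2 := by
  simp_rw [interpolationMap_apply_sq hv, mul_sub, sum_sub_distrib, mul_assoc]

theorem interpolationMap_contracts {g v m : Fin n → ℝ} (hv : Function.Injective v)
    (hm : ∀ i, 0 ≤ m i)
    (hg : ∀ p : ℝ[X], p.degree < #{i | 0 < g i} → 0 ≤ ∑ i, m i * g i * p.eval (v i) ^ 2)
    (x : Fin n → ℝ) :
    ∑ i, m i * interpolationMap g v x i ^ 2 ≤ ∑ i, m i * x i ^ 2 := by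
  rw [sum_mul_interpolationMap_sq hv]
  have h1 := hg _ (Lagrange.degree_interpolate_lt (s := {i | 0 < g i}) (v := v)
    (fun i => (√(g i))⁻¹ * x i) hv.injOn)
  have h2 : ∑ i, m i * (if 0 < g i then x i ^ 2 else 0) ≤ ∑ i, m i * x i ^ 2 :=
    sum_le_sum fun i _ => mul_le_mul_of_nonneg_left (by split_ifs; exacts [le_rfl, sq_nonneg _]) (hm i)
  linarith

theorem IsDiagonalInterpolation.sum_nonneg {l h g v : Fin n → ℝ}
    (H : IsDiagonalInterpolation l h) (hl : ∀ i, 0 ≤ l i) (hv : Function.Injective v)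
    (hg : ∀ p : ℝ[X], p.degree < #{i | 0 < g i} → 0 ≤ ∑ i, g i * p.eval (v i) ^ 2)
    (hlg : ∀ p : ℝ[X], p.degree < #{i | 0 < g i} → 0 ≤ ∑ i, l i * g i * p.eval (v i) ^ 2)
    {p : ℝ[X]} (hp : p.degree < #{i | 0 < g i}) :
    0 ≤ ∑ i, h i * g i * p.eval (v i) ^ 2 := by
  have h0 := interpolationMap_contracts (m := 1) hv (fun _ => zero_le_one) (by simpa using hg)
  have h1 := interpolationMap_contracts hv hl hlg
  simp only [Pi.one_apply, one_mul] at h0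
  -- The test vector is chosen so that its interpolant is $p$ itself. It vanishes where $g_i\le0$,
  -- so the inequality reduces to the claim.
  have h2 := H _ h0 h1 fun i => if 0 < g i then √(g i) * p.eval (v i) else 0
  have hint : Lagrange.interpolate {i | 0 < g i} v (fun i => (√(g i))⁻¹ *
      (if 0 < g i then √(g i) * p.eval (v i) else 0)) = p := by
    refine (Lagrange.eq_interpolate_of_eval_eq _ hv.injOn hp fun i hi => ?_).symm
    have hi' : 0 < g i := by simpa using hi
    have := (Real.sqrt_pos.2 hi').ne'
    simp only [hi', if_true]
    field_simp
  rw [sum_mul_interpolationMap_sq hv, hint] at h2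
  have h3 : ∀ i, (if 0 < g i then (if 0 < g i then √(g i) * p.eval (v i) else 0) ^ 2 else 0) =
      (if 0 < g i then √(g i) * p.eval (v i) else 0) ^ 2 := fun i => by split_ifs <;> simp
  simp_rw [h3] at h2
  linarith

theorem sum_nodalWeight_mul_eval {v : Fin n → ℝ} (hv : Function.Injective v) {p : ℝ[X]}
    (hp : p.degree < n) :
    ∑ i, Lagrange.nodalWeight univ v i * p.eval (v i) = p.coeff (n - 1) := by
  have := Lagrange.coeff_eq_sum (s := univ) hv.injOn (P := p) (by simpa using hp)
  rw [card_univ, Fintype.card_fin] at this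
  rw [this]
  exact sum_congr rfl fun i _ => by rw [Lagrange.nodalWeight, prod_inv_distrib]; ring

/-- Lagrange's formula evaluated at $0$, where the nodal polynomial of the $-l_i$ is $\prod l_i$. -/
theorem sum_nodalWeight_div_mul_eval {l : Fin n → ℝ} (hl : Function.Injective l)
    (hpos : ∀ i, 0 < l i) {p : ℝ[X]} (hp : p.degree < n) :
    (∏ i, l i) * ∑ i, Lagrange.nodalWeight univ (-l) i / l i * p.eval (-l i) = p.eval 0 := by
  have hv : Function.Injective (-l) := neg_injective.comp hl
  conv_rhs => rw [Lagrange.eq_interpolate (s := univ) (v := -l) (f := p) hv.injOn (by simpa using hp)]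
  rw [Lagrange.eval_interpolate_not_at_node _ (fun i _ => by simpa using (hpos i).ne'),
    Lagrange.eval_nodal]
  simp [div_eq_mul_inv]

/-- The factor $(l_j-l_i)^{-1}$ is negative exactly when $j<i$, which happens $i$ times. -/
theorem nodalWeight_sign {l : Fin n → ℝ} (hl : StrictMono l) (i : Fin n) :
    0 < (-1) ^ (i : ℕ) * Lagrange.nodalWeight univ (-l) i := by
  have h1 : (-1 : ℝ) ^ (i : ℕ) = ∏ j ∈ univ.erase i, if j < i then (-1 : ℝ) else 1 := by
    rw [prod_ite, prod_const_one, mul_one, prod_const]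
    congr 1
    rw [← Fin.card_Iio]
    congr 1
    ext j
    simp only [mem_Iio, mem_filter, mem_erase, mem_univ, and_true]
    exact ⟨fun h => ⟨h.ne, h⟩, fun h => h.2⟩
  rw [h1, Lagrange.nodalWeight, ← prod_mul_distrib]
  refine prod_pos fun j hj => ?_
  have hji : j ≠ i := (mem_erase.1 hj).1
  simp only [Pi.neg_apply]
  split_ifs with h
  · have : 0 < l i - l j := sub_pos.2 (hl h)
    have e : (-1) * (-l i - -l j)⁻¹ = (l i - l j)⁻¹ := by rw [← inv_neg_one, ← mul_inv]; ring_nf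
    rw [e]; positivity
  · have : 0 < l j - l i := sub_pos.2 (hl (lt_of_le_of_ne (not_lt.1 h) hji.symm))
    have e : 1 * (-l i - -l j)⁻¹ = (l j - l i)⁻¹ := by ring_nf
    rw [e]; positivity

theorem nodalWeight_pos_iff {l : Fin n → ℝ} (hl : StrictMono l) (i : Fin n) :
    0 < Lagrange.nodalWeight univ (-l) i ↔ Even (i : ℕ) := by
  have h := nodalWeight_sign hl i
  rcases Nat.even_or_odd (i : ℕ) with hi | hi
  · rw [hi.neg_one_pow, one_mul] at h
    exact ⟨fun _ => hi, fun _ => h⟩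
  · rw [hi.neg_one_pow] at h
    exact ⟨fun h' => by linarith, fun h' => absurd hi (Nat.not_odd_iff_even.2 h')⟩

theorem neg_nodalWeight_pos_iff {l : Fin n → ℝ} (hl : StrictMono l) (i : Fin n) :
    0 < -Lagrange.nodalWeight univ (-l) i ↔ ¬ Even (i : ℕ) := by
  rw [← nodalWeight_pos_iff hl]
  have h := nodalWeight_sign hl i
  have h0 : Lagrange.nodalWeight univ (-l) i ≠ 0 := by rintro h'; simp [h'] at h
  rw [neg_pos, not_lt]
  exact ⟨le_of_lt, fun h => lt_of_le_of_ne h h0⟩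

theorem card_filter_even (n : ℕ) : #{i : Fin n | Even (i : ℕ)} = (n + 1) / 2 := by
  rw [card_filter, Fin.sum_univ_eq_sum_range (fun i => if Even i then 1 else 0) n]
  induction n with
  | zero => rfl
  | succ k ih =>
    rw [sum_range_succ, ih]
    split_ifs with h
    · obtain ⟨m, rfl⟩ := h; omega
    · obtain ⟨m, rfl⟩ := Nat.not_even_iff_odd.1 h; omega

theorem card_filter_not_even (n : ℕ) : #{i : Fin n | ¬ Even (i : ℕ)} = n / 2 := by
  have := card_filter_add_card_filter_not (s := (univ : Finset (Fin n))) (fun i => Even (i : ℕ))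
  rw [card_filter_even, card_univ, Fintype.card_fin] at this
  omega

/-- With $g_i=w_i/l_i$, the two contraction sums are $q(0)^2/\prod l_i$ and the coefficient of
$X^{n-1}$ in $q^2$. The latter is zero or a leading coefficient, hence nonnegative. -/
theorem IsDiagonalInterpolation.sum_sq_nonneg {l h : Fin n → ℝ}
    (H : IsDiagonalInterpolation l h) (hl : StrictMono l) (hpos : ∀ i, 0 < l i) {p : ℝ[X]}
    (hp : p.degree < ((n + 1) / 2 : ℕ)) :
    0 ≤ ∑ i, h i * (Lagrange.nodalWeight univ (-l) i / l i) * p.eval (-l i) ^ 2 := by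
  have hcard : #{i | 0 < Lagrange.nodalWeight univ (-l) i / l i} = (n + 1) / 2 := by
    rw [← card_filter_even]
    congr 1; ext i
    rw [mem_filter, mem_filter, ← nodalWeight_pos_iff hl, div_pos_iff_of_pos_right (hpos i)]
  have hv : Function.Injective (-l) := neg_injective.comp hl.injective
  have hdeg : ∀ p : ℝ[X], p.degree < ((n + 1) / 2 : ℕ) → p ≠ 0 → (p ^ 2).natDegree < n :=
    fun p hp hp0 => by
      have := (natDegree_lt_iff_degree_lt hp0).2 hp
      rw [natDegree_pow]; omega
  refine H.sum_nonneg (fun i => (hpos i).le) hv (fun q hq => ?_) (fun q hq => ?_) (hcard ▸ hp)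
  · rw [hcard] at hq
    rcases eq_or_ne q 0 with rfl | hq0
    · simp
    have hd := (natDegree_lt_iff_degree_lt (pow_ne_zero 2 hq0)).1 (hdeg q hq hq0)
    have := sum_nodalWeight_div_mul_eval hl.injective hpos hd
    simp only [eval_pow] at this
    refine nonneg_of_mul_nonneg_right (this.symm ▸ sq_nonneg _) (prod_pos fun i _ => hpos i)
  · rw [hcard] at hq
    rcases eq_or_ne q 0 with rfl | hq0
    · simp
    have hd := (natDegree_lt_iff_degree_lt (pow_ne_zero 2 hq0)).1 (hdeg q hq hq0)
    have := sum_nodalWeight_mul_eval hv hd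
    have hc : 0 ≤ (q ^ 2).coeff (n - 1) :=
      coeff_nonneg_of_natDegree_le (by have := hdeg q hq hq0; omega)
        (by rw [leadingCoeff_pow]; positivity)
    refine (hc.trans this.ge).trans_eq (sum_congr rfl fun i _ => ?_)
    rw [mul_div_cancel₀ _ (hpos i).ne', eval_pow, Pi.neg_apply]

/-- With $g_i=-w_i$, the first contraction sum vanishes because $\deg q^2<n-1$. As $-l_i$ is the
node, the second is the coefficient of $X^{n-1}$ in $Xq^2$. -/
theorem IsDiagonalInterpolation.sum_mul_sq_nonneg {l h : Fin n → ℝ}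
    (H : IsDiagonalInterpolation l h) (hl : StrictMono l) (hpos : ∀ i, 0 < l i) {p : ℝ[X]}
    (hp : p.degree < (n / 2 : ℕ)) :
    0 ≤ ∑ i, h i * (-Lagrange.nodalWeight univ (-l) i) * p.eval (-l i) ^ 2 := by
  have hcard : #{i | 0 < -Lagrange.nodalWeight univ (-l) i} = n / 2 := by
    rw [← card_filter_not_even]
    congr 1; ext i
    rw [mem_filter, mem_filter, ← neg_nodalWeight_pos_iff hl]
  have hv : Function.Injective (-l) := neg_injective.comp hl.injective
  have hdeg : ∀ p : ℝ[X], p.degree < (n / 2 : ℕ) → p ≠ 0 →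
      (p ^ 2).natDegree < n - 1 ∧ (X * p ^ 2).natDegree < n := fun p hp hp0 => by
    have := (natDegree_lt_iff_degree_lt hp0).2 hp
    rw [natDegree_mul X_ne_zero (pow_ne_zero 2 hp0), natDegree_pow, natDegree_X]; omega
  refine H.sum_nonneg (fun i => (hpos i).le) hv (fun q hq => ?_) (fun q hq => ?_) (hcard ▸ hp)
  · rw [hcard] at hq
    rcases eq_or_ne q 0 with rfl | hq0
    · simp
    have h1 := (hdeg q hq hq0).1
    have hd := (natDegree_lt_iff_degree_lt (pow_ne_zero 2 hq0)).1 (h1.trans_le (Nat.sub_le n 1))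
    have := sum_nodalWeight_mul_eval hv hd
    rw [coeff_eq_zero_of_natDegree_lt h1] at this
    simp only [eval_pow] at this
    simp only [neg_mul, sum_neg_distrib, this, neg_zero, le_refl]
  · rw [hcard] at hq
    rcases eq_or_ne q 0 with rfl | hq0
    · simp
    have h1 := (hdeg q hq hq0).2
    have hd := (natDegree_lt_iff_degree_lt
      (mul_ne_zero X_ne_zero (pow_ne_zero 2 hq0))).1 h1
    have := sum_nodalWeight_mul_eval hv hd
    have hc : 0 ≤ (X * q ^ 2).coeff (n - 1) :=
      coeff_nonneg_of_natDegree_le (by omega)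
        (by rw [leadingCoeff_mul, leadingCoeff_pow, leadingCoeff_X]; positivity)
    refine (hc.trans this.ge).trans_eq (sum_congr rfl fun i _ => ?_)
    rw [eval_mul, eval_pow, eval_X, Pi.neg_apply]
    ring

/-- The dual description of interpolation: `h` is nonnegative on every functional that is
nonnegative on all the kernels `l ↦ l / (u + l)`. -/
theorem IsDiagonalInterpolation.sum_mul_nonneg {l h s : Fin n → ℝ}
    (H : IsDiagonalInterpolation l h) (hl : StrictMono l) (hpos : ∀ i, 0 < l i)
    (hs : ∀ u, 0 ≤ u → 0 ≤ ∑ i, s i * (l i / (u + l i))) :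
    0 ≤ ∑ i, h i * s i := by
  rcases Nat.eq_zero_or_pos n with rfl | hn
  · simp
  have hv : Function.Injective (-l) := neg_injective.comp hl.injective
  have hw : ∀ i, Lagrange.nodalWeight univ (-l) i ≠ 0 := fun i =>
    Lagrange.nodalWeight_ne_zero hv.injOn (mem_univ i)
  -- With these values the interpolant is $\prod(u+l_i)\cdot\sum s_il_i/(u+l_i)$.
  set r : Fin n → ℝ := fun i => s i * l i / Lagrange.nodalWeight univ (-l) i with hr
  have hnonneg : ∀ u, 0 ≤ u → 0 ≤ (Lagrange.interpolate univ (-l) r).eval u := fun u hu => by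
    have hul : ∀ i, 0 < u + l i := fun i => by linarith [hpos i]
    rw [Lagrange.eval_interpolate_not_at_node _ (fun i _ => by
      have := hul i; simp only [Pi.neg_apply]; intro h; linarith), Lagrange.eval_nodal]
    refine mul_nonneg (prod_nonneg fun i _ => by have := hul i; simp; linarith)
      ((hs u hu).trans_eq (sum_congr rfl fun i _ => ?_))
    have := hw i
    have := (hul i).ne'
    simp only [Pi.neg_apply, sub_neg_eq_add, hr]
    field_simp
  obtain ⟨a, b, hab⟩ := isHalfLineSquare_of_nonneg _ hnonneg
  obtain ⟨ha, hb⟩ := degree_lt_of_halfLineSquare hab hn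
    (by simpa using Lagrange.degree_interpolate_lt (s := univ) r hv.injOn)
  -- At the node $-l_i$, $Xb^2$ becomes $-l_ib^2$; this factor $-l_i$ turns the weight $w_i/l_i$
  -- into $-w_i$.
  refine (add_nonneg (H.sum_sq_nonneg hl hpos ha) (H.sum_mul_sq_nonneg hl hpos hb)).trans_eq ?_
  rw [← sum_add_distrib]
  refine sum_congr rfl fun i _ => ?_
  have h1 := Lagrange.eval_interpolate_at_node r hv.injOn (mem_univ i)
  rw [hab] at h1
  simp only [eval_add, eval_mul, eval_pow, eval_X, Pi.neg_apply, hr] at h1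
  have := hw i
  have := (hpos i).ne'
  have h2 : s i = (a.eval (-l i) ^ 2 + -l i * b.eval (-l i) ^ 2) *
      Lagrange.nodalWeight univ (-l) i / l i := by
    rw [h1]; field_simp
  rw [h2]
  field_simp

end Diagonal

/-! ### Vectors represented by measures -/

section Representation

open MeasureTheory

theorem measurable_pickKernel (l : ℝ) : Measurable (pickKernel l) := by
  unfold pickKernel
  exact Measurable.ite (measurableSet_singleton _) measurable_const (by fun_prop)

theorem pickKernel_nonneg {l : ℝ} (hl : 0 < l) (t : ℝ≥0∞) : 0 ≤ pickKernel l t := by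
  unfold pickKernel
  split_ifs <;> positivity

/-- For finite $t$ the kernel is a weighted harmonic mean of $l$ and $1$. -/
theorem pickKernel_le {l : ℝ} (hl : 0 < l) (t : ℝ≥0∞) : pickKernel l t ≤ max 1 l := by
  unfold pickKernel
  split_ifs
  · exact le_max_left _ _
  · have ht : 0 ≤ t.toReal := ENNReal.toReal_nonneg
    rw [div_le_iff₀ (by positivity)]
    nlinarith [le_max_left 1 l, le_max_right 1 l,
      mul_le_mul_of_nonneg_right (le_max_left 1 l) (mul_nonneg ht hl.le)]

theorem integrable_pickKernel {l : ℝ} (hl : 0 < l) (ϱ : Measure ℝ≥0∞) [IsFiniteMeasure ϱ] :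
    Integrable (pickKernel l) ϱ :=
  Integrable.of_bound (measurable_pickKernel l).aestronglyMeasurable (max 1 l)
    (Filter.Eventually.of_forall fun t => by
      rw [Real.norm_of_nonneg (pickKernel_nonneg hl t)]
      exact pickKernel_le hl t)

/-- `y` is the vector of values at the points `l i` of a function of class `P'`. -/
def IsPickVector {ι : Type*} (l y : ι → ℝ) : Prop :=
  ∃ ϱ : Measure ℝ≥0∞, IsFiniteMeasure ϱ ∧ ∀ i, y i = ∫ t, pickKernel (l i) t ∂ϱ

variable {ι : Type*} {l : ι → ℝ}

theorem IsPickVector.add (hl : ∀ i, 0 < l i) {y z : ι → ℝ} (hy : IsPickVector l y)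
    (hz : IsPickVector l z) : IsPickVector l (y + z) := by
  obtain ⟨ϱ, hϱ, hy⟩ := hy
  obtain ⟨σ, hσ, hz⟩ := hz
  refine ⟨ϱ + σ, inferInstance, fun i => ?_⟩
  rw [integral_add_measure (integrable_pickKernel (hl i) ϱ) (integrable_pickKernel (hl i) σ),
    Pi.add_apply, hy, hz]

theorem IsPickVector.smul {c : ℝ} (hc : 0 ≤ c) {y : ι → ℝ} (hy : IsPickVector l y) :
    IsPickVector l (c • y) := by
  obtain ⟨ϱ, hϱ, hy⟩ := hy
  refine ⟨ENNReal.ofReal c • ϱ, ϱ.smul_finite ENNReal.ofReal_ne_top, fun i => ?_⟩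
  rw [integral_smul_measure, ENNReal.toReal_ofReal hc, Pi.smul_apply, hy]

theorem isPickVector_pickKernel (t : ℝ≥0∞) : IsPickVector l fun i => pickKernel (l i) t :=
  ⟨Measure.dirac t, inferInstance, fun _ => (integral_dirac _ t).symm⟩

/-- The kernels `pickKernel l t`, with `t = θ / (1 - θ)` and `θ ∈ [0, 1]`. -/
theorem exists_pickKernel_eq {θ : ℝ} (h0 : 0 ≤ θ) (h1 : θ ≤ 1) :
    ∃ t, ∀ l : ℝ, 0 < l → pickKernel l t = l / (1 - θ + θ * l) := by
  rcases h1.eq_or_lt with rfl | h1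
  · exact ⟨∞, fun l hl => by simp [pickKernel, hl.ne']⟩
  · have hθ : 0 < 1 - θ := by linarith
    refine ⟨ENNReal.ofReal (θ / (1 - θ)), fun l hl => ?_⟩
    rw [pickKernel, if_neg ENNReal.ofReal_ne_top, ENNReal.toReal_ofReal (by positivity)]
    have : 0 < 1 - θ + θ * l := by positivity
    field_simp
    ring

/-- By Carathéodory, combinations of $\dim E+1$ points suffice, so the hull is a continuous image of
a compact set. -/
theorem IsCompact.convexHull_of_finiteDimensional {E : Type*} [NormedAddCommGroup E]
    [NormedSpace ℝ E] [FiniteDimensional ℝ E] {s : Set E} (hs : IsCompact s) :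
    IsCompact (convexHull ℝ s) := by
  rcases s.eq_empty_or_nonempty with rfl | ⟨x₀, hx₀⟩
  · simp
  set d := Module.finrank ℝ E + 1
  have hP : IsCompact ((fun p : (Fin d → ℝ) × (Fin d → E) => ∑ i, p.1 i • p.2 i) ''
      (stdSimplex ℝ (Fin d) ×ˢ Set.univ.pi fun _ => s)) :=
    ((isCompact_stdSimplex ℝ (Fin d)).prod (isCompact_univ_pi fun _ => hs)).image (by fun_prop)
  convert hP using 1
  refine Set.Subset.antisymm (fun x hx => ?_) ?_
  · obtain ⟨ι, _, z, w, hz, hind, hw, hw1, rfl⟩ := eq_pos_convex_span_of_mem_convexHull hx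
    have hcard : Fintype.card ι ≤ Fintype.card (Fin d) := by
      rw [Fintype.card_fin]
      exact hind.card_le_finrank_succ.trans (Nat.succ_le_succ (Submodule.finrank_le _))
    obtain ⟨e⟩ := Function.Embedding.nonempty_of_card_le hcard
    have hne : ∀ k, k ∉ Set.range e → ¬ ∃ a, e a = k := fun k hk => hk
    -- Unused slots get weight $0$ and the base point `x₀`.
    refine ⟨(Function.extend e w 0, Function.extend e z fun _ => x₀),
      ⟨⟨fun k => ?_, ?_⟩, fun k _ => ?_⟩, ?_⟩
    · by_cases hk : ∃ a, e a = k
      · obtain ⟨a, rfl⟩ := hk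
        simpa [e.injective.extend_apply] using (hw a).le
      · simp [Function.extend_apply' _ _ _ hk]
    · rw [← hw1]
      refine (Fintype.sum_of_injective e e.injective _ _ (fun k hk => ?_) fun i => ?_).symm
      · simp [Function.extend_apply' _ _ _ (hne k hk)]
      · simp [e.injective.extend_apply]
    · by_cases hk : ∃ a, e a = k
      · obtain ⟨a, rfl⟩ := hk
        simpa [e.injective.extend_apply] using hz ⟨a, rfl⟩
      · simpa [Function.extend_apply' _ _ _ hk] using hx₀
    · refine (Fintype.sum_of_injective e e.injective _ _ (fun k hk => ?_) fun i => ?_).symm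
      · simp [Function.extend_apply' _ _ _ (hne k hk)]
      · simp [e.injective.extend_apply]
  · rintro _ ⟨⟨w, z⟩, ⟨hw, hz⟩, rfl⟩
    exact (convex_convexHull ℝ s).sum_mem (fun i _ => hw.1 i) hw.2
      fun i _ => subset_convexHull ℝ s (hz i (Set.mem_univ i))

variable [Fintype ι]

/-- The kernels, scaled to have coordinate sum $1$, trace a compact curve over $\theta\in[0,1]$. Its
convex hull is closed, so Hahn–Banach separates the scaled `h` from it unless `h` lies in the cone.
-/
theorem isPickVector_of_dual (hl : ∀ i, 0 < l i) {h : ι → ℝ} (hh : ∀ i, 0 < h i)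
    (H : ∀ s : ι → ℝ, (∀ u, 0 ≤ u → 0 ≤ ∑ i, s i * (l i / (u + l i))) → 0 ≤ ∑ i, h i * s i) :
    IsPickVector l h := by
  classical
  rcases isEmpty_or_nonempty ι with _ | _
  · exact ⟨0, inferInstance, fun i => isEmptyElim i⟩
  set κ : ℝ → ι → ℝ := fun θ i => l i / (1 - θ + θ * l i) with hκ
  have hden : ∀ θ ∈ Set.Icc (0 : ℝ) 1, ∀ i, 0 < 1 - θ + θ * l i := fun θ hθ i => by
    rcases hθ.1.eq_or_lt with rfl | h
    · simp
    · have := hθ.2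
      have := mul_pos h (hl i)
      linarith
  have hΦ : ∀ θ ∈ Set.Icc (0 : ℝ) 1, 0 < ∑ i, κ θ i := fun θ hθ =>
    Finset.sum_pos (fun i _ => div_pos (hl i) (hden θ hθ i)) Finset.univ_nonempty
  have hΦh : 0 < ∑ i, h i := Finset.sum_pos (fun i _ => hh i) Finset.univ_nonempty
  have hcontκ : ∀ i, ContinuousOn (fun θ => κ θ i) (Set.Icc 0 1) := fun i =>
    ContinuousOn.div (by fun_prop) (by fun_prop) fun θ hθ => (hden θ hθ i).ne'
  have hcont : ContinuousOn (fun θ => (∑ i, κ θ i)⁻¹ • κ θ) (Set.Icc 0 1) :=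
    ContinuousOn.smul (ContinuousOn.inv₀ (continuousOn_finsetSum _ fun i _ => hcontκ i)
      fun θ hθ => (hΦ θ hθ).ne') (continuousOn_pi.2 hcontκ)
  have hclosed : IsClosed (convexHull ℝ ((fun θ => (∑ i, κ θ i)⁻¹ • κ θ) '' Set.Icc 0 1)) :=
    (isCompact_Icc.image_of_continuousOn hcont).convexHull_of_finiteDimensional.isClosed
  have hmem : (∑ i, h i)⁻¹ • h ∈
      convexHull ℝ ((fun θ => (∑ i, κ θ i)⁻¹ • κ θ) '' Set.Icc 0 1) := by
    by_contra hnot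
    obtain ⟨f, u, hf, hfu⟩ := geometric_hahn_banach_closed_point (convex_convexHull ℝ _)
      hclosed hnot
    -- The affine separation is made linear: $y\mapsto u\sum y_i-f(y)$ is positive on the kernels
    -- and would be negative at `h`.
    have hfsum : ∀ y : ι → ℝ, ∑ i, (u - f (Pi.single i 1)) * y i = u * ∑ i, y i - f y := by
      intro y
      have : f y = ∑ i, y i * f (Pi.single i 1) := by
        conv_lhs => rw [pi_eq_sum_univ' y]
        simp [map_sum]
      rw [this, Finset.mul_sum, ← Finset.sum_sub_distrib]
      exact Finset.sum_congr rfl fun i _ => by ring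
    have h1 := H (fun i => u - f (Pi.single i 1)) fun v hv => by
      have hθ : (1 + v)⁻¹ ∈ Set.Icc (0 : ℝ) 1 :=
        ⟨by positivity, inv_le_one_of_one_le₀ (by linarith)⟩
      have h2 := hf _ (subset_convexHull ℝ _ ⟨_, hθ, rfl⟩)
      simp only [map_smul, smul_eq_mul] at h2
      rw [inv_mul_lt_iff₀ (hΦ _ hθ), mul_comm, ← sub_pos, ← hfsum] at h2
      have h3 : ∑ i, (u - f (Pi.single i 1)) * κ (1 + v)⁻¹ i =
          (1 + v) * ∑ i, (u - f (Pi.single i 1)) * (l i / (v + l i)) := by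
        rw [Finset.mul_sum]
        refine Finset.sum_congr rfl fun i _ => ?_
        have h4 := (hden _ hθ i).ne'
        have h5 : v + l i ≠ 0 := (by have := hl i; positivity)
        have h6 : 1 + v ≠ 0 := by positivity
        have h7 : 1 - (1 + v)⁻¹ + (1 + v)⁻¹ * l i = (v + l i) / (1 + v) := by
          field_simp; ring
        simp only [hκ, h7]
        field_simp
      rw [h3] at h2
      exact (pos_of_mul_pos_right h2 (by positivity)).le
    simp only [map_smul, smul_eq_mul] at hfu
    rw [lt_inv_mul_iff₀ hΦh, mul_comm, ← sub_neg, ← hfsum] at hfu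
    refine absurd h1 (not_le.2 (hfu.trans_eq' (Finset.sum_congr rfl fun i _ => mul_comm _ _)))
  have hconv : Convex ℝ {y | IsPickVector l y} := fun y hy z hz a b ha hb _ =>
    (IsPickVector.smul ha hy).add hl (IsPickVector.smul hb hz)
  have hsub : (fun θ => (∑ i, κ θ i)⁻¹ • κ θ) '' Set.Icc 0 1 ⊆ {y | IsPickVector l y} := by
    rintro _ ⟨θ, hθ, rfl⟩
    refine IsPickVector.smul (inv_nonneg.2 (hΦ θ hθ).le) ?_
    obtain ⟨t, ht⟩ := exists_pickKernel_eq hθ.1 hθ.2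
    have := isPickVector_pickKernel (l := l) t
    simp_rw [ht _ (hl _)] at this
    exact this
  have := IsPickVector.smul hΦh.le (convexHull_min hsub hconv hmem)
  rwa [smul_inv_smul₀ hΦh.ne'] at this

end Representation

/-! ### Interpolation for functions of class `P'` -/

section Sufficiency

open MeasureTheory

variable {n : ℕ}

/-- After the triangle inequality the difference of the two sides is a multiple of $(|p|-\tau
l|q|)^2$. -/
theorem div_mul_norm_add_sq_le {l τ : ℝ} (hl : 0 < l) (hτ : 0 < τ) (p q : ℂ) :
    l / (1 + τ * l) * ‖p + q‖ ^ 2 ≤ ‖p‖ ^ 2 / τ + l * ‖q‖ ^ 2 := by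
  have h1 : ‖p + q‖ ^ 2 ≤ (‖p‖ + ‖q‖) ^ 2 :=
    pow_le_pow_left₀ (norm_nonneg _) (norm_add_le p q) 2
  refine (mul_le_mul_of_nonneg_left h1 (by positivity)).trans ?_
  have h2 : ‖p‖ ^ 2 / τ + l * ‖q‖ ^ 2 - l / (1 + τ * l) * (‖p‖ + ‖q‖) ^ 2 =
      (‖p‖ - τ * l * ‖q‖) ^ 2 / (τ * (1 + τ * l)) := by
    have : 1 + τ * l ≠ 0 := by positivity
    field_simp
    ring
  have h3 : 0 ≤ (‖p‖ - τ * l * ‖q‖) ^ 2 / (τ * (1 + τ * l)) := by positivity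
  linarith

theorem sum_pickKernel_contracts {l : Fin n → ℝ} (hl : ∀ i, 0 < l i)
    (S : (Fin n → ℂ) →ₗ[ℂ] (Fin n → ℂ)) {C : ℝ}
    (h0 : ∀ z, ∑ i, ‖S z i‖ ^ 2 ≤ C * ∑ i, ‖z i‖ ^ 2)
    (h1 : ∀ z, ∑ i, l i * ‖S z i‖ ^ 2 ≤ C * ∑ i, l i * ‖z i‖ ^ 2) (t : ℝ≥0∞) (z : Fin n → ℂ) :
    ∑ i, pickKernel (l i) t * ‖S z i‖ ^ 2 ≤ C * ∑ i, pickKernel (l i) t * ‖z i‖ ^ 2 := by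
  by_cases ht : t = ∞
  · simpa [pickKernel, ht] using h0 z
  set τ := t.toReal with hτ
  have hk : ∀ l, pickKernel l t = (1 + τ) * (l / (1 + τ * l)) := fun l => by
    rw [pickKernel, if_neg ht, mul_div_assoc]
  have hτ0 : 0 ≤ τ := ENNReal.toReal_nonneg
  simp_rw [hk, mul_assoc, ← Finset.mul_sum]
  rw [mul_left_comm C]
  refine mul_le_mul_of_nonneg_left ?_ (by linarith)
  rcases hτ0.eq_or_lt with h | hpos
  · simpa [← h] using h1 z
  -- The optimal splitting, $|p_i|=\tau l_i|q_i|$, for which the preceding bound is an equality.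
  set p : Fin n → ℂ := fun i => ((τ * l i / (1 + τ * l i) : ℝ) : ℂ) * z i with hp
  set q : Fin n → ℂ := fun i => ((1 / (1 + τ * l i) : ℝ) : ℂ) * z i with hq
  have hden : ∀ i, 0 < 1 + τ * l i := fun i => by have := hl i; positivity
  have hpq : z = p + q := by
    ext i
    have := (hden i).ne'
    rw [Pi.add_apply, hp, hq, ← add_mul, ← Complex.ofReal_add, ← add_div,
      add_comm (τ * l i), div_self this, Complex.ofReal_one, one_mul]
  calc ∑ i, l i / (1 + τ * l i) * ‖S z i‖ ^ 2
      ≤ ∑ i, (‖S p i‖ ^ 2 / τ + l i * ‖S q i‖ ^ 2) := Finset.sum_le_sum fun i _ => by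
        conv_lhs => rw [hpq, map_add, Pi.add_apply]
        exact div_mul_norm_add_sq_le (hl i) hpos _ _
    _ = (∑ i, ‖S p i‖ ^ 2) / τ + ∑ i, l i * ‖S q i‖ ^ 2 := by
        rw [Finset.sum_add_distrib, Finset.sum_div]
    _ ≤ (C * ∑ i, ‖p i‖ ^ 2) / τ + C * ∑ i, l i * ‖q i‖ ^ 2 :=
        add_le_add (div_le_div_of_nonneg_right (h0 p) hpos.le) (h1 q)
    _ = C * ∑ i, l i / (1 + τ * l i) * ‖z i‖ ^ 2 := by
        rw [mul_div_assoc, ← mul_add, Finset.sum_div, ← Finset.sum_add_distrib]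
        congr 1
        refine Finset.sum_congr rfl fun i _ => ?_
        have := (hden i).ne'
        have := hl i
        rw [hp, hq, norm_mul, norm_mul, Complex.norm_real, Complex.norm_real,
          Real.norm_of_nonneg (by have := hden i; positivity),
          Real.norm_of_nonneg (by have := hden i; positivity)]
        field_simp
        ring

theorem IsPickVector.contracts {l h : Fin n → ℝ} (hh : IsPickVector l h) (hl : ∀ i, 0 < l i)
    (S : (Fin n → ℂ) →ₗ[ℂ] (Fin n → ℂ)) {C : ℝ}
    (h0 : ∀ z, ∑ i, ‖S z i‖ ^ 2 ≤ C * ∑ i, ‖z i‖ ^ 2)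
    (h1 : ∀ z, ∑ i, l i * ‖S z i‖ ^ 2 ≤ C * ∑ i, l i * ‖z i‖ ^ 2) (z : Fin n → ℂ) :
    ∑ i, h i * ‖S z i‖ ^ 2 ≤ C * ∑ i, h i * ‖z i‖ ^ 2 := by
  obtain ⟨ϱ, hϱ, hh⟩ := hh
  have hint : ∀ z : Fin n → ℂ, ∀ i ∈ Finset.univ,
      Integrable (fun t => pickKernel (l i) t * ‖z i‖ ^ 2) ϱ := fun z i _ =>
    (integrable_pickKernel (hl i) ϱ).mul_const _
  have key : ∀ z : Fin n → ℂ, ∑ i, h i * ‖z i‖ ^ 2 =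
      ∫ t, ∑ i, pickKernel (l i) t * ‖z i‖ ^ 2 ∂ϱ := fun z => by
    rw [integral_finsetSum _ (hint z)]
    simp_rw [integral_mul_const, hh]
  rw [key, key, ← integral_const_mul]
  exact integral_mono (integrable_finsetSum _ (hint _))
    ((integrable_finsetSum _ (hint _)).const_mul _)
    fun t => sum_pickKernel_contracts hl S h0 h1 t z

end Sufficiency

/-! ### Operators that are diagonal in an orthonormal basis -/

section DiagonalOperators

open Polynomial

variable {ι E : Type*} [Fintype ι] [NormedAddCommGroup E] [InnerProductSpace ℂ E]

theorem OrthonormalBasis.inner_map_self_of_eigenvectors (b : OrthonormalBasis ι ℂ E)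
    {S : E →ₗ[ℂ] E} {d : ι → ℝ} (hS : ∀ i, S (b i) = (d i : ℂ) • b i) (x : E) :
    inner ℂ (S x) x = ((∑ i, d i * ‖b.repr x i‖ ^ 2 : ℝ) : ℂ) := by
  have h : S x = ∑ i, ((d i : ℂ) * b.repr x i) • b i := by
    conv_lhs => rw [← b.sum_repr x, map_sum]
    exact Finset.sum_congr rfl fun i _ => by rw [map_smul, hS, smul_smul, mul_comm]
  rw [h, sum_inner, Complex.ofReal_sum]
  refine Finset.sum_congr rfl fun i _ => ?_
  rw [inner_smul_left, ← b.repr_apply_apply, map_mul, Complex.conj_ofReal, mul_assoc,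
    Complex.conj_mul', Complex.ofReal_mul, Complex.ofReal_pow]

theorem ContinuousLinearMap.aeval_apply_eigenvector {a : E →L[ℂ] E} {x : E} {r : ℝ}
    (hx : a x = (r : ℂ) • x) (p : ℝ[X]) : aeval a p x = ((p.eval r : ℝ) : ℂ) • x := by
  induction p using Polynomial.induction_on' with
  | add p q hp hq =>
    rw [map_add, add_apply, hp, hq, eval_add, Complex.ofReal_add, add_smul]
  | monomial k c =>
    have hpow : (a ^ k) x = ((r ^ k : ℝ) : ℂ) • x := by
      induction k with
      | zero => simp
      | succ k ih =>
        rw [pow_succ', mul_apply_eq_comp, ih, map_smul, hx, smul_smul, pow_succ]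
        push_cast; rfl
    rw [aeval_monomial, eval_monomial, mul_apply_eq_comp, hpow,
      Algebra.algebraMap_eq_smul_one, smul_apply,
      one_apply_eq_self, Complex.ofReal_mul, mul_smul]
    rfl

variable [CompleteSpace E]

/-- The spectrum lies among the `l i`, since $\prod(X-l_i)$ annihilates `a`. There `f` agrees with
an interpolating polynomial, for which the claim is direct. -/
theorem OrthonormalBasis.cfc_apply_of_eigenvectors (b : OrthonormalBasis ι ℂ E)
    {a : E →L[ℂ] E} (ha : IsSelfAdjoint a) {l : ι → ℝ} (hl : ∀ i, a (b i) = (l i : ℂ) • b i)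
    (f : ℝ → ℝ) (i : ι) : cfc f a (b i) = (f (l i) : ℂ) • b i := by
  have hspec : spectrum ℝ a ⊆ Set.range l := fun r hr => by
    by_contra hnot
    set p : ℝ[X] := ∏ i, (X - C (l i)) with hp
    have h0 : aeval a p = 0 := by
      apply ContinuousLinearMap.coe_injective
      refine b.toBasis.ext fun i => ?_
      have : p.eval (l i) = 0 := by
        rw [hp, eval_prod]
        exact Finset.prod_eq_zero (Finset.mem_univ i) (by simp)
      simpa [this] using ContinuousLinearMap.aeval_apply_eigenvector (hl i) p
    have hmem := spectrum.subset_polynomial_aeval a p ⟨r, hr, rfl⟩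
    rw [h0, spectrum.mem_iff, sub_zero] at hmem
    refine hmem ((IsUnit.mk0 (p.eval r) ?_).map (algebraMap ℝ _))
    rw [hp, eval_prod, Finset.prod_ne_zero_iff]
    intro i _
    simpa [sub_eq_zero] using fun h => hnot ⟨i, h.symm⟩
  obtain ⟨q, hq⟩ := (Polynomial.exists_eval_eq_iff l (f ∘ l)).2 fun i j h => by simp [h]
  have hcongr : cfc f a = cfc q.eval a := cfc_congr fun r hr => by
    obtain ⟨j, rfl⟩ := hspec hr
    exact (hq j).symm
  rw [hcongr, cfc_polynomial q a ha, ContinuousLinearMap.aeval_apply_eigenvector (hl i), hq]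
  rfl

end DiagonalOperators

/-! ### Exact interpolation in coordinates -/

section Coordinates

/-- A shortcut instance, which keeps instance search away from the one for Hilbert C⋆-modules. -/
noncomputable instance HermSpace.instInner {V : Type*} [AddCommGroup V] [Module ℂ V]
    (c : InnerProductSpace.Core ℂ V) : Inner ℂ (HermSpace c) :=
  InnerProductSpace.toInner

theorem HermSpace.norm_equiv_sq {V : Type*} [AddCommGroup V] [Module ℂ V]
    (c : InnerProductSpace.Core ℂ V) (x : V) :
    ‖HermSpace.equiv c x‖ ^ 2 = (c.inner x x).re :=
  norm_sq_eq_re_inner (𝕜 := ℂ) (HermSpace.equiv c x)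

theorem HermSpace.norm_op_le_iff {V : Type*} [AddCommGroup V] [Module ℂ V]
    [FiniteDimensional ℂ V] (c : InnerProductSpace.Core ℂ V) (T : Module.End ℂ V) {M : ℝ}
    (hM : 0 ≤ M) :
    ‖HermSpace.op c T‖ ≤ M ↔ ∀ x, (c.inner (T x) (T x)).re ≤ M ^ 2 * (c.inner x x).re := by
  have h : ∀ x, ‖HermSpace.op c T (HermSpace.equiv c x)‖ ≤ M * ‖HermSpace.equiv c x‖ ↔
      (c.inner (T x) (T x)).re ≤ M ^ 2 * (c.inner x x).re := fun x => by
    rw [← HermSpace.norm_equiv_sq, ← HermSpace.norm_equiv_sq, ← mul_pow]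
    exact (pow_le_pow_iff_left₀ (norm_nonneg _) (by positivity) two_ne_zero).symm
  rw [ContinuousLinearMap.opNorm_le_iff hM]
  exact ⟨fun H x => (h x).1 (H _), fun H x => (h x).2 (H x)⟩

theorem isExactInterpolation_iff {V : Type*} [AddCommGroup V] [Module ℂ V]
    [FiniteDimensional ℂ V] (c₀ c₁ c : InnerProductSpace.Core ℂ V) :
    IsExactInterpolation c₀ c₁ c ↔ ∀ (T : Module.End ℂ V) (M : ℝ), 0 ≤ M →
      (∀ x, (c₀.inner (T x) (T x)).re ≤ M ^ 2 * (c₀.inner x x).re) →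
      (∀ x, (c₁.inner (T x) (T x)).re ≤ M ^ 2 * (c₁.inner x x).re) →
      ∀ x, (c.inner (T x) (T x)).re ≤ M ^ 2 * (c.inner x x).re := by
  constructor
  · intro H T M hM h0 h1
    exact (HermSpace.norm_op_le_iff c T hM).1 ((H T).trans (max_le
      ((HermSpace.norm_op_le_iff c₀ T hM).2 h0) ((HermSpace.norm_op_le_iff c₁ T hM).2 h1)))
  · intro H T
    have hM : 0 ≤ max ‖HermSpace.op c₀ T‖ ‖HermSpace.op c₁ T‖ := le_max_of_le_left (norm_nonneg _)
    exact (HermSpace.norm_op_le_iff c T hM).2 (H T _ hM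
      ((HermSpace.norm_op_le_iff c₀ T hM).1 (le_max_left _ _))
      ((HermSpace.norm_op_le_iff c₁ T hM).1 (le_max_right _ _)))

variable {V : Type*} [AddCommGroup V] [Module ℂ V] {n : ℕ}

/-- In the coordinates `ψ`, the squared norm of `c` is `∑ d i * ‖z i‖ ^ 2`. -/
def IsDiagonalNorm (c : InnerProductSpace.Core ℂ V) (ψ : V ≃ₗ[ℂ] (Fin n → ℂ))
    (d : Fin n → ℝ) : Prop :=
  ∀ x, (c.inner x x).re = ∑ i, d i * ‖ψ x i‖ ^ 2

variable [FiniteDimensional ℂ V] {c₀ c₁ c : InnerProductSpace.Core ℂ V}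
  {ψ : V ≃ₗ[ℂ] (Fin n → ℂ)} {l h : Fin n → ℝ}

theorem isExactInterpolation_of_isPickVector (hl : ∀ i, 0 < l i) (h0 : IsDiagonalNorm c₀ ψ 1)
    (h1 : IsDiagonalNorm c₁ ψ l) (hc : IsDiagonalNorm c ψ h) (hh : IsPickVector l h) :
    IsExactInterpolation c₀ c₁ c := by
  rw [isExactInterpolation_iff]
  intro T M _ hT0 hT1 x
  have hψ : ∀ z i, (ψ.conj T) z i = ψ (T (ψ.symm z)) i := fun z i => rfl
  have := hh.contracts hl (ψ.conj T) (C := M ^ 2) (fun z => ?_) (fun z => ?_) (ψ x)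
  · simpa only [hψ, ← hc _, ψ.symm_apply_apply] using this
  · have := hT0 (ψ.symm z)
    rw [h0, h0] at this
    simpa [hψ] using this
  · have := hT1 (ψ.symm z)
    rw [h1, h1] at this
    simpa [hψ] using this

/-- Changing the sign of one coordinate. -/
noncomputable def coordReflection (i : Fin n) : (Fin n → ℂ) →ₗ[ℂ] (Fin n → ℂ) :=
  LinearMap.pi fun j => (if j = i then (-1 : ℂ) else 1) • LinearMap.proj j

theorem norm_coordReflection_apply (i j : Fin n) (z : Fin n → ℂ) :
    ‖coordReflection i z j‖ = ‖z j‖ := by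
  by_cases hj : j = i <;> simp [coordReflection, hj]

theorem IsExactInterpolation.inner_coordReflection_le (H : IsExactInterpolation c₀ c₁ c)
    (h0 : IsDiagonalNorm c₀ ψ 1) (h1 : IsDiagonalNorm c₁ ψ l) (i : Fin n) (z : Fin n → ℂ) :
    (c.inner (ψ.symm (coordReflection i z)) (ψ.symm (coordReflection i z))).re ≤
      (c.inner (ψ.symm z) (ψ.symm z)).re := by
  have := (isExactInterpolation_iff c₀ c₁ c).1 H (ψ.symm.conj (coordReflection i)) 1 zero_le_one
    (fun x => ?_) (fun x => ?_) (ψ.symm z)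
  · simpa [LinearEquiv.conj_apply] using this
  · rw [h0, h0]; simp [norm_coordReflection_apply]
  · rw [h1, h1]; simp [norm_coordReflection_apply]

/-- The reflection gives $\|-x+wy\|\le\|x+wy\|$, that is $\mathrm{Re}\langle x,wy\rangle\ge0$, for
every complex $w$. -/
theorem IsExactInterpolation.inner_single_eq_zero (H : IsExactInterpolation c₀ c₁ c)
    (h0 : IsDiagonalNorm c₀ ψ 1) (h1 : IsDiagonalNorm c₁ ψ l) {i j : Fin n} (hij : i ≠ j) :
    c.inner (ψ.symm (Pi.single i 1)) (ψ.symm (Pi.single j 1)) = 0 := by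
  let E := HermSpace c
  set x : E := HermSpace.equiv c (ψ.symm (Pi.single i 1))
  set y : E := HermSpace.equiv c (ψ.symm (Pi.single j 1))
  change inner ℂ x y = 0
  have hi : coordReflection i (Pi.single i 1) = -(Pi.single i 1 : Fin n → ℂ) := by
    ext k; by_cases hk : k = i <;> simp [coordReflection, hk]
  have hj : coordReflection i (Pi.single j 1) = (Pi.single j 1 : Fin n → ℂ) := by
    ext k; by_cases hk : k = i
    · subst hk; simp [coordReflection, hij]
    · simp [coordReflection, hk]
  have key : ∀ w : ℂ, 0 ≤ (inner ℂ x (w • y)).re := fun w => by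
    have := H.inner_coordReflection_le h0 h1 i (Pi.single i 1 + w • Pi.single j 1)
    rw [map_add, map_smul, hi, hj, map_add, map_neg, map_add, map_smul,
      ← HermSpace.norm_equiv_sq, ← HermSpace.norm_equiv_sq, map_add, map_add, map_neg, map_smul]
      at this
    change ‖-x + w • y‖ ^ 2 ≤ ‖x + w • y‖ ^ 2 at this
    rw [norm_add_sq (𝕜 := ℂ), norm_add_sq (𝕜 := ℂ), inner_neg_left, norm_neg] at this
    simp only [RCLike.re_to_complex, Complex.neg_re] at this
    linarith
  -- This $w$ makes the real part equal to $-|\langle x,y\rangle|^2$.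
  have h2 := key (-(starRingEnd ℂ (inner ℂ x y)))
  rw [inner_smul_right, neg_mul, Complex.conj_mul', Complex.neg_re, ← Complex.ofReal_pow,
    Complex.ofReal_re] at h2
  have h3 : ‖(inner ℂ x y : ℂ)‖ ^ 2 = 0 := le_antisymm (by linarith) (sq_nonneg _)
  simpa using h3

theorem IsExactInterpolation.exists_isDiagonalNorm (H : IsExactInterpolation c₀ c₁ c)
    (h0 : IsDiagonalNorm c₀ ψ 1) (h1 : IsDiagonalNorm c₁ ψ l) :
    ∃ d : Fin n → ℝ, (∀ i, 0 < d i) ∧ IsDiagonalNorm c ψ d := by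
  set e : Fin n → HermSpace c := fun i => HermSpace.equiv c (ψ.symm (Pi.single i 1)) with he
  refine ⟨fun i => ‖e i‖ ^ 2, fun i => ?_, fun x => ?_⟩
  · have : e i ≠ 0 := by simp [he]
    positivity
  · have hx : HermSpace.equiv c x = ∑ i, ψ x i • e i := by
      simp only [he]
      simp_rw [← map_smul, ← map_sum]
      rw [← pi_eq_sum_univ' (ψ x), ψ.symm_apply_apply]
    have horth : ∀ i j, i ≠ j → inner ℂ (e i) (e j) = 0 := fun i j hij =>
      H.inner_single_eq_zero h0 h1 hij
    rw [← HermSpace.norm_equiv_sq, hx, norm_sq_eq_re_inner (𝕜 := ℂ), sum_inner, map_sum]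
    refine Finset.sum_congr rfl fun i _ => ?_
    rw [inner_sum, Finset.sum_eq_single i (fun j _ hj => by
        rw [inner_smul_left, inner_smul_right, horth i j hj.symm]; simp) (by simp),
      ← norm_sq_eq_re_inner, norm_smul]
    ring

/-- The complexification of a real linear map. -/
noncomputable def complexifyPi (T : (Fin n → ℝ) →ₗ[ℝ] (Fin n → ℝ)) :
    (Fin n → ℂ) →ₗ[ℂ] (Fin n → ℂ) :=
  Matrix.toLin' ((LinearMap.toMatrix' T).map Complex.ofReal)

theorem complexifyPi_apply (T : (Fin n → ℝ) →ₗ[ℝ] (Fin n → ℝ)) (z : Fin n → ℂ) (i : Fin n) :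
    complexifyPi T z i = ⟨T (fun j => (z j).re) i, T (fun j => (z j).im) i⟩ := by
  have hT : ∀ x, T x i = ∑ j, LinearMap.toMatrix' T i j * x j := fun x => by
    conv_lhs => rw [← Matrix.toLin'_toMatrix' T]
    rfl
  have hz : complexifyPi T z i = ∑ j, ((LinearMap.toMatrix' T i j : ℝ) : ℂ) * z j := rfl
  rw [hz, hT, hT]
  apply Complex.ext <;> simp

theorem norm_complexifyPi_sq (T : (Fin n → ℝ) →ₗ[ℝ] (Fin n → ℝ)) (z : Fin n → ℂ) (i : Fin n) :
    ‖complexifyPi T z i‖ ^ 2 = T (fun j => (z j).re) i ^ 2 + T (fun j => (z j).im) i ^ 2 := by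
  rw [complexifyPi_apply, ← Complex.normSq_eq_norm_sq, Complex.normSq_mk]
  ring

/-- Real and imaginary parts are mapped separately and their squares add. -/
theorem complexifyPi_contracts {m : Fin n → ℝ} {T : (Fin n → ℝ) →ₗ[ℝ] (Fin n → ℝ)}
    (hT : ∀ x, ∑ i, m i * T x i ^ 2 ≤ ∑ i, m i * x i ^ 2) (z : Fin n → ℂ) :
    ∑ i, m i * ‖complexifyPi T z i‖ ^ 2 ≤ ∑ i, m i * ‖z i‖ ^ 2 := by
  have hz : ∀ i, ‖z i‖ ^ 2 = (z i).re ^ 2 + (z i).im ^ 2 := fun i => by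
    rw [← Complex.normSq_eq_norm_sq, Complex.normSq_apply]; ring
  simp_rw [norm_complexifyPi_sq, hz, mul_add, Finset.sum_add_distrib]
  exact add_le_add (hT _) (hT _)

theorem IsExactInterpolation.isDiagonalInterpolation (H : IsExactInterpolation c₀ c₁ c)
    (h0 : IsDiagonalNorm c₀ ψ 1) (h1 : IsDiagonalNorm c₁ ψ l) (hc : IsDiagonalNorm c ψ h) :
    IsDiagonalInterpolation l h := by
  intro T hT0 hT1 x
  have hψ : ∀ x, ψ (ψ.symm.conj (complexifyPi T) x) = complexifyPi T (ψ x) := fun x => by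
    simp [LinearEquiv.conj_apply]
  have := (isExactInterpolation_iff c₀ c₁ c).1 H (ψ.symm.conj (complexifyPi T)) 1 zero_le_one
    (fun x => ?_) (fun x => ?_) (ψ.symm fun i => (x i : ℂ))
  · rw [hc, hc] at this
    simpa [hψ, norm_complexifyPi_sq, ← Pi.zero_def] using this
  · rw [h0, h0]
    simpa [hψ] using complexifyPi_contracts (m := 1) (by simpa using hT0) (ψ x)
  · rw [h1, h1]
    simpa [hψ] using complexifyPi_contracts hT1 (ψ x)

theorem isExactInterpolation_iff_exists_isPickVector (hl : StrictMono l) (hpos : ∀ i, 0 < l i)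
    (h0 : IsDiagonalNorm c₀ ψ 1) (h1 : IsDiagonalNorm c₁ ψ l) :
    IsExactInterpolation c₀ c₁ c ↔ ∃ h, IsPickVector l h ∧ IsDiagonalNorm c ψ h := by
  constructor
  · intro H
    obtain ⟨h, hh, hc⟩ := H.exists_isDiagonalNorm h0 h1
    exact ⟨h, isPickVector_of_dual hpos hh fun s hs =>
      (H.isDiagonalInterpolation h0 h1 hc).sum_mul_nonneg hl hpos hs, hc⟩
  · rintro ⟨h, hh, hc⟩
    exact isExactInterpolation_of_isPickVector hpos h0 h1 hc hh

end Coordinates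

/-! ### Simultaneous diagonalisation of the couple -/

section Diagonalisation

variable {V : Type*} [AddCommGroup V] [Module ℂ V] {c₀ c₁ : InnerProductSpace.Core ℂ V}
  {A : Module.End ℂ V} {n : ℕ}

theorem InnerProductSpace.Core.inner_self_eq_re (c : InnerProductSpace.Core ℂ V) (x : V) :
    c.inner x x = ((c.inner x x).re : ℂ) :=
  (Complex.conj_eq_iff_re.1 (c.conj_inner_symm x x)).symm

/-- The coordinates on `V` given by an orthonormal basis for `c₀`. -/
noncomputable def HermSpace.coords (b : OrthonormalBasis (Fin n) ℂ (HermSpace c₀)) :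
    V ≃ₗ[ℂ] (Fin n → ℂ) :=
  (HermSpace.equiv c₀).trans (b.repr.toLinearEquiv.trans (WithLp.linearEquiv 2 ℂ (Fin n → ℂ)))

theorem HermSpace.isDiagonalNorm_one (b : OrthonormalBasis (Fin n) ℂ (HermSpace c₀)) :
    IsDiagonalNorm c₀ (HermSpace.coords b) 1 := fun x => by
  rw [← HermSpace.norm_equiv_sq, ← b.repr.norm_map, EuclideanSpace.norm_sq_eq]
  simp only [Pi.one_apply, one_mul]
  rfl

variable [FiniteDimensional ℂ V]

theorem HermSpace.inner_op_self (hA : IsRepresentingOperator c₀ c₁ A) (x : V) :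
    inner ℂ (HermSpace.op c₀ A (HermSpace.equiv c₀ x)) (HermSpace.equiv c₀ x) =
      c₁.inner x x :=
  (hA x).symm

theorem IsRepresentingOperator.isSymmetric (hA : IsRepresentingOperator c₀ c₁ A) :
    (HermSpace.op c₀ A : HermSpace c₀ →ₗ[ℂ] HermSpace c₀).IsSymmetric := by
  rw [LinearMap.isSymmetric_iff_inner_map_self_real]
  intro x
  have : inner ℂ (HermSpace.op c₀ A x) x = c₁.inner x x := HermSpace.inner_op_self hA x
  exact (congrArg (starRingEnd ℂ) this).trans ((c₁.conj_inner_symm x x).trans this.symm)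

theorem IsRepresentingOperator.exists_eigenbasis (hn : Module.finrank ℂ V = n)
    (hA : IsRepresentingOperator c₀ c₁ A)
    (hsimple : ∀ μ : ℂ, A.HasEigenvalue μ → Module.finrank ℂ (A.eigenspace μ) = 1) :
    ∃ (b : OrthonormalBasis (Fin n) ℂ (HermSpace c₀)) (l : Fin n → ℝ), StrictMono l ∧
      (∀ i, 0 < l i) ∧ ∀ i, HermSpace.op c₀ A (b i) = (l i : ℂ) • b i := by
  have hs := hA.isSymmetric
  have hn' : Module.finrank ℂ (HermSpace c₀) = n := hn
  have hcard := hs.card_filter_eigenvalues_eq hn'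
  have hinj : Function.Injective (hs.eigenvalues hn') := fun i j hij => by
    have h1 : A.HasEigenvalue (hs.eigenvalues hn' i : ℂ) := hs.hasEigenvalue_eigenvalues hn' i
    have h2 := (hcard (hs.eigenvalues hn' i : ℂ)).trans (hsimple _ h1)
    exact Finset.card_le_one.1 h2.le i (by simp) j (by simp [hij])
  -- `eigenvalues` is listed in decreasing order, hence the reversal.
  refine ⟨(hs.eigenvectorBasis hn').reindex Fin.revPerm, hs.eigenvalues hn' ∘ Fin.rev,
    fun i j hij => ?_, fun i => ?_, fun i => ?_⟩
  · exact ((hs.eigenvalues_antitone hn').strictAnti_of_injective hinj) (Fin.rev_lt_rev.2 hij)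
  · set j := Fin.rev i
    have h1 : (HermSpace.op c₀ A) (hs.eigenvectorBasis hn' j) =
      (hs.eigenvalues hn' j : ℂ) • hs.eigenvectorBasis hn' j := hs.apply_eigenvectorBasis hn' j
    -- The eigenvalue is the squared $c_1$-norm of its unit eigenvector, hence positive.
    have h2 := HermSpace.inner_op_self hA ((HermSpace.equiv c₀).symm (hs.eigenvectorBasis hn' j))
    rw [LinearEquiv.apply_symm_apply, h1, inner_smul_left, inner_self_eq_norm_sq_to_K,
      (hs.eigenvectorBasis hn').norm_eq_one, Complex.conj_ofReal, c₁.inner_self_eq_re] at h2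
    have h3 : hs.eigenvalues hn' j = _ := Complex.ofReal_injective (by simpa using h2)
    change 0 < hs.eigenvalues hn' j
    rw [h3, ← HermSpace.norm_equiv_sq]
    have : hs.eigenvectorBasis hn' j ≠ 0 := (hs.eigenvectorBasis hn').orthonormal.ne_zero j
    have : HermSpace.equiv c₁ ((HermSpace.equiv c₀).symm (hs.eigenvectorBasis hn' j)) ≠ 0 := by
      simpa using this
    positivity
  · rw [OrthonormalBasis.reindex_apply]
    exact hs.apply_eigenvectorBasis hn' _

/-- Over $\mathbf{C}$ an operator is determined by its quadratic form. -/
theorem IsRepresentingOperator.isDiagonalNorm_iff (hA : IsRepresentingOperator c₀ c₁ A)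
    (b : OrthonormalBasis (Fin n) ℂ (HermSpace c₀)) {S : HermSpace c₀ →L[ℂ] HermSpace c₀}
    {d : Fin n → ℝ} (hS : ∀ i, S (b i) = (d i : ℂ) • b i) :
    IsDiagonalNorm c₁ (HermSpace.coords b) d ↔ HermSpace.op c₀ A = S := by
  have hd : ∀ x : HermSpace c₀, inner ℂ (S x) x = _ :=
    b.inner_map_self_of_eigenvectors (S := (S : HermSpace c₀ →ₗ[ℂ] HermSpace c₀)) hS
  rw [← ContinuousLinearMap.coe_inj, ← ext_inner_map]
  refine forall_congr' fun x => ?_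
  have h1 : inner ℂ ((HermSpace.op c₀ A : HermSpace c₀ →ₗ[ℂ] HermSpace c₀) x) x =
      ((c₁.inner x x).re : ℂ) := (HermSpace.inner_op_self hA x).trans (c₁.inner_self_eq_re x)
  have h2 : inner ℂ ((S : HermSpace c₀ →ₗ[ℂ] HermSpace c₀) x) x = _ := hd x
  refine Iff.trans ?_ (Eq.congr h1 h2).symm
  rw [Complex.ofReal_inj]
  rfl

end Diagonalisation

theorem theorem3p8 (n : ℕ)
    (c₀ c₁ c : InnerProductSpace.Core ℂ (Fin n → ℂ))
    (A B : Module.End ℂ (Fin n → ℂ))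
    (hA : IsRepresentingOperator c₀ c₁ A)
    (hsimple : ∀ μ : ℂ, A.HasEigenvalue μ → Module.finrank ℂ (A.eigenspace μ) = 1)
    (hB : IsRepresentingOperator c₀ c B) :
    IsExactInterpolation c₀ c₁ c ↔
      ∃ h : ℝ → ℝ, IsPickPrime h ∧
        HermSpace.op c₀ B = cfc h (HermSpace.op c₀ A) := by
  obtain ⟨b, l, hl, hpos, hb⟩ := hA.exists_eigenbasis (Module.finrank_fin_fun ℂ) hsimple
  have hsa : IsSelfAdjoint (HermSpace.op c₀ A) :=
    ContinuousLinearMap.isSelfAdjoint_iff_isSymmetric.2 hA.isSymmetric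
  have hcfc : ∀ f : ℝ → ℝ, IsDiagonalNorm c (HermSpace.coords b) (f ∘ l) ↔
      HermSpace.op c₀ B = cfc f (HermSpace.op c₀ A) := fun f =>
    hB.isDiagonalNorm_iff b fun i => b.cfc_apply_of_eigenvectors hsa hb f i
  rw [isExactInterpolation_iff_exists_isPickVector hl hpos (HermSpace.isDiagonalNorm_one b)
    ((hA.isDiagonalNorm_iff b hb).2 rfl)]
  constructor
  · rintro ⟨h, ⟨ϱ, hϱ, hh⟩, hc⟩
    refine ⟨fun r => ∫ t, pickKernel r t ∂ϱ, ⟨ϱ, hϱ, fun _ _ => rfl⟩, (hcfc _).1 ?_⟩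
    rwa [show (fun r => ∫ t, pickKernel r t ∂ϱ) ∘ l = h from funext fun i => (hh i).symm]
  · rintro ⟨h, ⟨ϱ, hϱ, hh⟩, hBh⟩
    exact ⟨h ∘ l, ⟨ϱ, hϱ, fun i => hh _ (hpos i)⟩, (hcfc h).2 hBh⟩
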